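/- Let $\mathrm{Sg}(x)=1$ for $x\ge 0$ and $\mathrm{Sg}(x)=-1$ for $x<0$. An overpartition of $m$ is a non-increasing sequence of positive integers with sum $m$ in which the first occurrence of each number may be overlined. For an integer $m$ let $p\overline{pp}(m)$ be the number of triplets $(\lambda,\alpha,\beta)$, where $\lambda$ is an ordinary partition, $\alpha$ and $\beta$ are overpartitions, and $|\lambda|+|\alpha|+|\beta|=m$; in particular $p\overline{pp}(m)=0$ for $m<0$. Then for every integer $n\ge 1$ and all $a,b\in\mathbb{Z}$, $$\mathrm{Sg}(a+b)\sum_{i=a}^{b}(6i+1)\,p\overline{pp}\!\left(n-\frac{i(3i+1)}{2}\right)\ge 0,$$ where the sum is empty (equal to $0$) if $a>b$. -/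

import Mathlib

namespace BilateralQuintuple

/-- The sign function with `Sg x = 1` for `x ≥ 0` (in particular `Sg 0 = 1`) and `Sg x = -1` for
`x < 0`. -/
def Sg (x : ℤ) : ℤ := if 0 ≤ x then 1 else -1

/-- An overpartition of `n`: a non-increasing sequence of positive integers with sum `n` in which
the first occurrence of each number may be overlined. Such a sequence is a partition of `n` together
with the set of those among its distinct part sizes whose first occurrence is overlined. -/
@[ext]
structure Overpartition (n : ℕ) where
  /-- the underlying partition, forgetting the overlines -/
  toPartition : n.Partition
  /-- the numbers whose first occurrence is overlined -/
  overlined : Finset ℕ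
  overlined_subset : overlined ⊆ toPartition.parts.toFinset

/-- A triplet consisting of an ordinary partition and two overpartitions, of total size `m`.
The total size is allowed to be an arbitrary integer `m`, so that there is no triplet when `m` is
negative. -/
structure Triplet (m : ℤ) where
  size₁ : ℕ
  size₂ : ℕ
  size₃ : ℕ
  size_add : (size₁ : ℤ) + size₂ + size₃ = m
  part₁ : size₁.Partition
  part₂ : Overpartition size₂
  part₃ : Overpartition size₃

/-- The number of triplets of an ordinary partition and two overpartitions of total size `m`;
it is `0` for negative `m`. -/
noncomputable def ppp (m : ℤ) : ℕ := Nat.card (Triplet m)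

/-- There are only finitely many overpartitions of `n`. -/
instance (n : ℕ) : Finite (Overpartition n) :=
  Finite.of_injective
    (fun o : Overpartition n =>
      (⟨o.toPartition, ⟨o.overlined, Finset.mem_powerset.2 o.overlined_subset⟩⟩ :
        Σ p : n.Partition, p.parts.toFinset.powerset))
    (by
      rintro ⟨p, s, hs⟩ ⟨q, t, ht⟩ h
      simp only [Sigma.mk.injEq] at h
      obtain ⟨rfl, h⟩ := h
      simpa using h)

/-- There are only finitely many triplets of a given total size, so `ppp` is a genuine count. -/
instance (m : ℤ) : Finite (Triplet m) :=
  Finite.of_injective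
    (fun t : Triplet m =>
      (⟨(⟨t.size₁, by have := t.size_add; omega⟩, ⟨t.size₂, by have := t.size_add; omega⟩,
          ⟨t.size₃, by have := t.size_add; omega⟩), t.part₁, t.part₂, t.part₃⟩ :
        Σ i : Fin (m.toNat + 1) × Fin (m.toNat + 1) × Fin (m.toNat + 1),
          (i.1 : ℕ).Partition × Overpartition i.2.1 × Overpartition i.2.2))
    (by
      rintro ⟨a, b, c, h, p, q, r⟩ ⟨a', b', c', h', p', q', r'⟩ e
      simp only [Sigma.mk.injEq, Prod.mk.injEq, Fin.mk.injEq] at e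
      obtain ⟨⟨rfl, rfl, rfl⟩, e⟩ := e
      simpa using e)

end BilateralQuintuple

set_option linter.unusedSimpArgs false

namespace BilateralQuintuple

open PowerSeries Filter Topology
open scoped PowerSeries.WithPiTopology

/-! With P and O the generating functions of partitions and overpartitions, P·O² is the reciprocal
of the full series ∑ (6i+1) q^(i(3i+1)/2), by the quintuple product identity divided by 1 - z at z =
1. Hence the sum over all integers i vanishes for n ≥ 1, and the theorem concerns the sign of
truncations. Since the i-th term has the sign of 6i+1, only the windows [-N, N] (sum ≥ 0) and [-N-1,
N] (sum ≤ 0) matter: any other mixed window differs from one of them by terms of the favourable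
sign.

For these windows P·O² times the truncated series is the limit, as the order m grows, of finite
forms `evenTrunc m N` and `oddTrunc m N`. Untruncated, the finite forms equal 1 (`evenTrunc_self`,
`oddTrunc_self`). At order N + 1 the truncation omits a single term of known sign
(`neg_evenTerm_zero_mem`, `oddTerm_zero_mem`). Raising the order by one changes it by `evenStep` or
`-oddStep`, by a telescoping of WZ type (`evenTrunc_sub`, `oddTrunc_sub`), and both steps have
nonnegative coefficients because they are built from Gaussian binomials (`evenStep_mem`,
`oddStep_mem`). So `evenTrunc m N - 1` and `1 - oddTrunc m N` have nonnegative coefficients for m >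
N, and this survives in the limit. -/

/-! ### Finite q-products, Lambert sums and nonnegativity of coefficients -/

/-- The power series `1 / (1 - X ^ (j + 1))`. -/
noncomputable def geom (j : ℕ) : ℤ⟦X⟧ := invOfUnit (1 - X ^ (j + 1)) 1

/-- The finite product `(q; q)_n`. -/
noncomputable def poch (n : ℕ) : ℤ⟦X⟧ := ∏ j ∈ Finset.range n, (1 - X ^ (j + 1))

/-- The finite product `(-q; q)_n`. -/
noncomputable def negPoch (n : ℕ) : ℤ⟦X⟧ := ∏ j ∈ Finset.range n, (1 + X ^ (j + 1))

/-- The inverse of `(q; q)_n`. -/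
noncomputable def invPoch (n : ℕ) : ℤ⟦X⟧ := ∏ j ∈ Finset.range n, geom j

/-- The partial sum `∑ q ^ j / (1 - q ^ j)`, `1 ≤ j ≤ n`, of the Lambert series. -/
noncomputable def lambert (n : ℕ) : ℤ⟦X⟧ := ∑ j ∈ Finset.range n, X ^ (j + 1) * geom j

lemma one_sub_mul_geom (j : ℕ) : (1 - X ^ (j + 1)) * geom j = 1 :=
  mul_invOfUnit _ _ (by simp)

lemma poch_succ (n : ℕ) : poch (n + 1) = poch n * (1 - X ^ (n + 1)) := Finset.prod_range_succ ..
lemma negPoch_succ (n : ℕ) : negPoch (n + 1) = negPoch n * (1 + X ^ (n + 1)) :=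
  Finset.prod_range_succ ..
lemma invPoch_succ (n : ℕ) : invPoch (n + 1) = invPoch n * geom n := Finset.prod_range_succ ..
lemma lambert_succ (n : ℕ) : lambert (n + 1) = lambert n + X ^ (n + 1) * geom n :=
  Finset.sum_range_succ ..
@[simp] lemma poch_zero : poch 0 = 1 := rfl
@[simp] lemma negPoch_zero : negPoch 0 = 1 := rfl
@[simp] lemma invPoch_zero : invPoch 0 = 1 := rfl
@[simp] lemma lambert_zero : lambert 0 = 0 := rfl

lemma poch_mul_invPoch (n : ℕ) : poch n * invPoch n = 1 := by
  rw [poch, invPoch, ← Finset.prod_mul_distrib]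
  exact Finset.prod_eq_one fun j _ => one_sub_mul_geom j

/-- The subsemiring of power series with nonnegative coefficients. -/
noncomputable def nonnegCoeff : Subsemiring ℤ⟦X⟧ where
  carrier := {f | ∀ n, 0 ≤ coeff n f}
  mul_mem' {f g} hf hg n := by
    rw [coeff_mul]; exact Finset.sum_nonneg fun p _ => mul_nonneg (hf _) (hg _)
  one_mem' n := by rw [coeff_one]; split_ifs <;> simp
  add_mem' {f g} hf hg n := by rw [map_add]; exact add_nonneg (hf n) (hg n)
  zero_mem' n := by simp

lemma mem_nonnegCoeff {f : ℤ⟦X⟧} : f ∈ nonnegCoeff ↔ ∀ n, 0 ≤ coeff n f := Iff.rfl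

lemma X_mem : (X : ℤ⟦X⟧) ∈ nonnegCoeff := fun n => by rw [coeff_X]; split_ifs <;> simp

lemma X_pow_mem (n : ℕ) : (X : ℤ⟦X⟧) ^ n ∈ nonnegCoeff := pow_mem X_mem n

lemma geom_mem (j : ℕ) : geom j ∈ nonnegCoeff := by
  have h : geom j = 1 + X ^ (j + 1) * geom j := by linear_combination one_sub_mul_geom j
  intro n
  induction n using Nat.strong_induction_on with
  | _ n ih =>
    rw [h, map_add, coeff_X_pow_mul']
    refine add_nonneg (one_mem nonnegCoeff n) ?_
    split_ifs
    · exact ih _ (by omega)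
    · exact le_rfl

lemma negPoch_mem (n : ℕ) : negPoch n ∈ nonnegCoeff :=
  prod_mem fun _ _ => add_mem (one_mem _) (X_pow_mem _)

lemma invPoch_mem (n : ℕ) : invPoch n ∈ nonnegCoeff := prod_mem fun j _ => geom_mem j

lemma lambert_sub_mem {m n : ℕ} (h : m ≤ n) : lambert n - lambert m ∈ nonnegCoeff := by
  induction n, h using Nat.le_induction with
  | base => simp
  | succ n _ ih =>
    rw [lambert_succ, add_sub_right_comm]
    exact add_mem ih (mul_mem (X_pow_mem _) (geom_mem _))

/-- Gaussian binomial coefficients have nonnegative coefficients. -/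
lemma poch_mul_invPoch_mul_invPoch_mem (u v : ℕ) :
    poch (u + v) * invPoch u * invPoch v ∈ nonnegCoeff := by
  induction u generalizing v with
  | zero => simp [poch_mul_invPoch]
  | succ u ihu =>
    induction v with
    | zero => simp [poch_mul_invPoch]
    | succ v ihv =>
      -- The q-Pascal rule.
      have e : poch (u + 1 + (v + 1)) * invPoch (u + 1) * invPoch (v + 1)
          = poch (u + (v + 1)) * invPoch u * invPoch (v + 1)
            + X ^ (u + 1) * (poch (u + 1 + v) * invPoch (u + 1) * invPoch v) := by
        rw [show u + 1 + (v + 1) = (u + v + 1) + 1 by ring, show u + (v + 1) = u + v + 1 by ring,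
          show u + 1 + v = u + v + 1 by ring, poch_succ (u + v + 1), invPoch_succ u, invPoch_succ v]
        linear_combination (poch (u + v + 1) * invPoch u * invPoch v)
          * (geom v * one_sub_mul_geom u + X ^ (u + 1) * geom u * one_sub_mul_geom v)
      rw [e]
      exact add_mem (ihu _) (mul_mem (X_pow_mem _) ihv)

/-- `∏ (1 - q ^ j)⁻¹` over `1 ≤ j ≤ n` stays nonnegative after removing one factor. -/
lemma one_sub_mul_invPoch_mem {j n : ℕ} (h : j < n) :
    (1 - X ^ (j + 1)) * invPoch n ∈ nonnegCoeff := by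
  rw [invPoch, ← Finset.mul_prod_erase _ _ (Finset.mem_range.2 h), ← mul_assoc, one_sub_mul_geom,
    one_mul]
  exact prod_mem fun j _ => geom_mem j

lemma lambert_sub_term_mem {j n : ℕ} (h : j < n) :
    lambert n - X ^ (j + 1) * geom j ∈ nonnegCoeff := by
  rw [lambert, ← Finset.add_sum_erase _ _ (Finset.mem_range.2 h), add_sub_cancel_left]
  exact sum_mem fun j _ => mul_mem (X_pow_mem _) (geom_mem _)

/-! ### Terms of the finite forms and their increments -/

/-- The generalized pentagonal exponent `k (3k + 1) / 2`. -/
def pent (k : ℕ) : ℕ := k * (3 * k + 1) / 2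

lemma two_mul_pent (k : ℕ) : 2 * pent k = k * (3 * k + 1) := by
  refine Nat.mul_div_cancel' ?_
  rcases Nat.even_or_odd' k with ⟨c, rfl | rfl⟩
  · exact ⟨c * (3 * (2 * c) + 1), by ring⟩
  · exact ⟨(2 * c + 1) * (3 * c + 2), by ring⟩

lemma pent_succ (k : ℕ) : pent (k + 1) = pent k + 3 * k + 2 := by
  have h1 := two_mul_pent k
  have h2 := two_mul_pent (k + 1)
  nlinarith

/-- The central term of the finite form, of order `m`, of the symmetric truncation. -/
noncomputable def evenCenter (m : ℕ) : ℤ⟦X⟧ :=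
  poch (2 * m) * negPoch m ^ 2 * invPoch m ^ 4

/-- The pair of terms with index `±(K + 1)` in the finite form of order `a + K + 1` of the
symmetric truncation. -/
noncomputable def evenTerm (a K : ℕ) : ℤ⟦X⟧ :=
  X ^ (pent K + 2 * K + 1) * (poch (2 * (a + K + 1)) * negPoch (a + K + 1) ^ 2 * invPoch a ^ 2 *
    invPoch (a + 2 * K + 2) ^ 2) * ((1 - X ^ (K + 1)) * (1 - 6 * ((K : ℤ⟦X⟧) + 1)
      - 4 * (lambert (a + 2 * K + 2) - lambert a)) + 2 * X ^ (K + 1))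

/-- The increment of the symmetric truncation between the orders `a + 1 + N` and `a + 2 + N`. -/
noncomputable def evenStep (a N : ℕ) : ℤ⟦X⟧ :=
  X ^ (pent N + N + 1 + (a + 1 + N)) * (poch (2 * (a + 1 + N)) * negPoch (a + 1 + N) ^ 2) *
    (invPoch (a + 1) * invPoch (a + 1 + 2 * N) * invPoch a * invPoch (a + 2 + 2 * N) *
      (6 * (N : ℤ⟦X⟧) + 3 + 2 * ((lambert (a + 2 + 2 * N) - lambert a)
        + (lambert (a + 1 + 2 * N) - lambert (a + 1)))) +
    (1 - X ^ (2 * (a + 1 + N) + 1)) * invPoch (a + 1) ^ 2 * invPoch (a + 2 + 2 * N) ^ 2 *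
      (1 + X ^ (a + 1 + N + 1)) * (6 * (N : ℤ⟦X⟧) + 3 + 4 * (lambert (a + 2 + 2 * N) - lambert (a + 1))))

/-- The pair of terms with index `K` and `-K - 1` in the finite form of order `a + K` of the
asymmetric truncation. -/
noncomputable def oddTerm (a K : ℕ) : ℤ⟦X⟧ :=
  X ^ pent K * (poch (2 * (a + K) + 1) * negPoch (a + K) ^ 2 * invPoch a ^ 2 *
    invPoch (a + 2 * K + 1) ^ 2) * ((1 - X ^ (2 * K + 1)) * (6 * (K : ℤ⟦X⟧) + 1
      + 4 * (lambert (a + 2 * K + 1) - lambert a)) - 4 * X ^ (2 * K + 1))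

/-- The decrement of the asymmetric truncation between the orders `a + 1 + N` and `a + 2 + N`. -/
noncomputable def oddStep (a N : ℕ) : ℤ⟦X⟧ :=
  X ^ (pent N + 2 * N + 2 + (a + 1 + N)) *
    (poch (2 * (a + 1 + N) + 1) * negPoch (a + 1 + N) ^ 2) *
    (invPoch (a + 1) * invPoch (a + 2 + 2 * N) * invPoch a * invPoch (a + 3 + 2 * N) *
      (6 * (N : ℤ⟦X⟧) + 5 + (6 * (N : ℤ⟦X⟧) + 7) * X ^ (N + 1) + (1 + X ^ (N + 1)) *
        (2 * ((lambert (a + 3 + 2 * N) - lambert a)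
        + (lambert (a + 2 + 2 * N) - lambert (a + 1))))) +
    (1 - X ^ (2 * (a + 1 + N) + 2)) * invPoch (a + 1) ^ 2 * invPoch (a + 3 + 2 * N) ^ 2 *
      (1 + X ^ (a + 1 + N + 1)) * (6 * (N : ℤ⟦X⟧) + 5 + (6 * (N : ℤ⟦X⟧) + 7) * X ^ (N + 1) + (1 + X ^ (N + 1)) *
        (4 * (lambert (a + 3 + 2 * N) - lambert (a + 1)))))

/-! ### Rational function identities behind the telescoping -/

section Field

variable {F : Type*} [Field F]

/-- This is `evenTerm_sub` stripped of its common factor, with x = q^(a+1), r = q^(K+1), k = K + 1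
and H a difference of Lambert sums. None of the relations between these quantities is needed, so
they are independent variables. -/
lemma even_core (q x r k H : F) (h₁ : 1 - x ≠ 0) (h₂ : 1 - q * x ≠ 0) (h₃ : 1 - x * r ^ 2 ≠ 0)
    (h₄ : 1 - q * x * r ^ 2 ≠ 0) :
    (1 - q * x ^ 2 * r ^ 2) * (1 - q ^ 2 * x ^ 2 * r ^ 2) * (1 + q * x * r) ^ 2 *
        ((1 - q * x)⁻¹ ^ 2 * (1 - q * x * r ^ 2)⁻¹ ^ 2) * ((1 - r) * (1 - 6 * k - 4 *
          (H + q * x * r ^ 2 * (1 - q * x * r ^ 2)⁻¹ - q * x * (1 - q * x)⁻¹)) + 2 * r)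
      - ((1 - r) * (1 - 6 * k - 4 * H) + 2 * r)
      = q * x * r ^ 3 * ((1 - x) * (1 - q * x * r ^ 2)⁻¹ * (6 * k + 3 + 2 * (2 * H
            + q * x * r ^ 2 * (1 - q * x * r ^ 2)⁻¹ + x * (1 - x)⁻¹))
          + (1 - q * x ^ 2 * r ^ 2) * (1 - q * x * r ^ 2)⁻¹ ^ 2 * (1 + q * x * r) *
            (6 * k + 3 + 4 * (H + q * x * r ^ 2 * (1 - q * x * r ^ 2)⁻¹)))
        - q * x * ((1 - x * r ^ 2) * (1 - q * x)⁻¹ * (6 * k - 3 + 2 * (2 * H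
            - x * r ^ 2 * (1 - x * r ^ 2)⁻¹ - q * x * (1 - q * x)⁻¹))
          + (1 - q * x ^ 2 * r ^ 2) * (1 - q * x)⁻¹ ^ 2 * (1 + q * x * r) *
            (6 * k - 3 + 4 * (H - q * x * (1 - q * x)⁻¹))) := by
  field_simp
  ring

/-- The boundary counterpart of `even_core` at x = 1, formally a = -1, where x / (1 - x) is
singular; the upper step gives way to the newly appearing term. -/
lemma even_core_last (q r k H : F) (h₂ : 1 - q ≠ 0) (h₃ : 1 - r ^ 2 ≠ 0)
    (h₄ : 1 - q * r ^ 2 ≠ 0) (h₅ : 1 - q ^ 2 * r ^ 2 ≠ 0) :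
    (1 - q * r ^ 2) * (1 - q ^ 2 * r ^ 2) * (1 + q * r) ^ 2 *
        ((1 - q)⁻¹ ^ 2 * (1 - q * r ^ 2)⁻¹ ^ 2) * ((1 - r) * (1 - 6 * k - 4 *
          (H + q * r ^ 2 * (1 - q * r ^ 2)⁻¹ - q * (1 - q)⁻¹)) + 2 * r)
      - ((1 - r) * (1 - 6 * k - 4 * H) + 2 * r)
      + q * ((1 - r ^ 2) * (1 - q)⁻¹ * (6 * k - 3 + 2 * (2 * H
            - r ^ 2 * (1 - r ^ 2)⁻¹ - q * (1 - q)⁻¹))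
          + (1 - q * r ^ 2) * (1 - q)⁻¹ ^ 2 * (1 + q * r) *
            (6 * k - 3 + 4 * (H - q * (1 - q)⁻¹)))
      + r ^ 3 * q * (1 + q * r) ^ 2 * ((1 - q * r ^ 2) * (1 - q ^ 2 * r ^ 2) *
        ((1 - q * r ^ 2)⁻¹ ^ 2 * (1 - q ^ 2 * r ^ 2)⁻¹ ^ 2)) *
        ((1 - q * r) * (1 - 6 * (k + 1) - 4 * (H + q * r ^ 2 * (1 - q * r ^ 2)⁻¹
          + q ^ 2 * r ^ 2 * (1 - q ^ 2 * r ^ 2)⁻¹)) + 2 * (q * r)) = 0 := by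
  field_simp
  ring

/-- The analogue of `even_core` for `oddTerm_sub`; again x = q^(a+1), r = q^(K+1), and k = K + 1 is
now the index of the term itself. -/
lemma odd_core (q x r k H : F) (h₁ : 1 - x ≠ 0) (h₂ : 1 - q * x ≠ 0) (h₃ : 1 - q * x * r ^ 2 ≠ 0)
    (h₄ : 1 - q ^ 2 * x * r ^ 2 ≠ 0) :
    (1 - q ^ 2 * x ^ 2 * r ^ 2) * (1 - q ^ 3 * x ^ 2 * r ^ 2) * (1 + q * x * r) ^ 2 *
        ((1 - q * x)⁻¹ ^ 2 * (1 - q ^ 2 * x * r ^ 2)⁻¹ ^ 2) * ((1 - q * r ^ 2) * (6 * k + 1 + 4 *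
          (H + q ^ 2 * x * r ^ 2 * (1 - q ^ 2 * x * r ^ 2)⁻¹ - q * x * (1 - q * x)⁻¹))
          - 4 * (q * r ^ 2))
      - ((1 - q * r ^ 2) * (6 * k + 1 + 4 * H) - 4 * (q * r ^ 2))
      = q * x * ((1 - q * x * r ^ 2) * (1 - q * x)⁻¹ * (6 * k - 1 + (6 * k + 1) * r + (1 + r) *
            (2 * (2 * H - q * x * r ^ 2 * (1 - q * x * r ^ 2)⁻¹ - q * x * (1 - q * x)⁻¹)))
          + (1 - q ^ 2 * x ^ 2 * r ^ 2) * (1 - q * x)⁻¹ ^ 2 * (1 + q * x * r) *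
            (6 * k - 1 + (6 * k + 1) * r + (1 + r) * (4 * (H - q * x * (1 - q * x)⁻¹))))
       - q ^ 2 * x * r ^ 3 * ((1 - x) * (1 - q ^ 2 * x * r ^ 2)⁻¹ *
            (6 * k + 5 + (6 * k + 7) * (q * r) + (1 + q * r) * (2 * (2 * H
            + q ^ 2 * x * r ^ 2 * (1 - q ^ 2 * x * r ^ 2)⁻¹ + x * (1 - x)⁻¹)))
          + (1 - q ^ 2 * x ^ 2 * r ^ 2) * (1 - q ^ 2 * x * r ^ 2)⁻¹ ^ 2 * (1 + q * x * r) *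
            (6 * k + 5 + (6 * k + 7) * (q * r) + (1 + q * r) *
              (4 * (H + q ^ 2 * x * r ^ 2 * (1 - q ^ 2 * x * r ^ 2)⁻¹)))) := by
  field_simp
  ring

lemma odd_core_last (q r k H : F) (h₂ : 1 - q ≠ 0) (h₃ : 1 - q * r ^ 2 ≠ 0)
    (h₄ : 1 - q ^ 2 * r ^ 2 ≠ 0) (h₅ : 1 - q ^ 3 * r ^ 2 ≠ 0) :
    (1 - q ^ 2 * r ^ 2) * (1 - q ^ 3 * r ^ 2) * (1 + q * r) ^ 2 *
        ((1 - q)⁻¹ ^ 2 * (1 - q ^ 2 * r ^ 2)⁻¹ ^ 2) * ((1 - q * r ^ 2) * (6 * k + 1 + 4 *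
          (H + q ^ 2 * r ^ 2 * (1 - q ^ 2 * r ^ 2)⁻¹ - q * (1 - q)⁻¹))
          - 4 * (q * r ^ 2))
      - ((1 - q * r ^ 2) * (6 * k + 1 + 4 * H) - 4 * (q * r ^ 2))
      - q * ((1 - q * r ^ 2) * (1 - q)⁻¹ * (6 * k - 1 + (6 * k + 1) * r + (1 + r) *
            (2 * (2 * H - q * r ^ 2 * (1 - q * r ^ 2)⁻¹ - q * (1 - q)⁻¹)))
          + (1 - q ^ 2 * r ^ 2) * (1 - q)⁻¹ ^ 2 * (1 + q * r) *
            (6 * k - 1 + (6 * k + 1) * r + (1 + r) * (4 * (H - q * (1 - q)⁻¹))))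
      + q ^ 2 * r ^ 3 * (1 + q * r) ^ 2 * ((1 - q ^ 2 * r ^ 2) * (1 - q ^ 3 * r ^ 2) *
        ((1 - q ^ 2 * r ^ 2)⁻¹ ^ 2 * (1 - q ^ 3 * r ^ 2)⁻¹ ^ 2)) *
        ((1 - q ^ 3 * r ^ 2) * (6 * (k + 1) + 1 + 4 * (H + q ^ 2 * r ^ 2 * (1 - q ^ 2 * r ^ 2)⁻¹
          + q ^ 3 * r ^ 2 * (1 - q ^ 3 * r ^ 2)⁻¹)) - 4 * (q ^ 3 * r ^ 2)) = 0 := by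
  field_simp
  ring

end Field

/-! ### Telescoping identities for power series -/

lemma one_sub_X_pow_ne_zero (j : ℕ) :
    1 - algebraMap ℤ⟦X⟧ (FractionRing ℤ⟦X⟧) X ^ (j + 1) ≠ 0 := by
  intro h
  have := congrArg (algebraMap ℤ⟦X⟧ (FractionRing ℤ⟦X⟧)) (one_sub_mul_geom j)
  simp [h] at this

lemma algebraMap_geom (j : ℕ) : algebraMap ℤ⟦X⟧ (FractionRing ℤ⟦X⟧) (geom j)
    = (1 - algebraMap ℤ⟦X⟧ (FractionRing ℤ⟦X⟧) X ^ (j + 1))⁻¹ := by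
  have := congrArg (algebraMap ℤ⟦X⟧ (FractionRing ℤ⟦X⟧)) (one_sub_mul_geom j)
  simp only [map_mul, map_sub, map_pow, map_one] at this
  exact eq_inv_of_mul_eq_one_right this

lemma invPoch_eq (n : ℕ) : invPoch n = invPoch (n + 1) * (1 - X ^ (n + 1)) := by
  rw [invPoch_succ]
  linear_combination -invPoch n * one_sub_mul_geom n

lemma lambert_eq (n : ℕ) : lambert n = lambert (n + 1) - X ^ (n + 1) * geom n := by
  rw [lambert_succ]; ring

lemma poch_double_succ (m : ℕ) : poch (2 * (m + 1))
    = poch (2 * m) * (1 - X ^ (2 * m + 1)) * (1 - X ^ (2 * m + 2)) := by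
  rw [show 2 * (m + 1) = 2 * m + 1 + 1 by ring, poch_succ, poch_succ]

lemma poch_double_succ_add_one (m : ℕ) : poch (2 * (m + 1) + 1)
    = poch (2 * m + 1) * (1 - X ^ (2 * m + 2)) * (1 - X ^ (2 * m + 3)) := by
  rw [show 2 * (m + 1) + 1 = 2 * m + 1 + 1 + 1 by ring, poch_succ, poch_succ]

lemma evenTerm_eq {a K m b : ℕ} (hm : m = a + K + 1) (hb : b = a + 2 * K + 2) :
    evenTerm a K = X ^ (pent K + 2 * K + 1) * (poch (2 * m) * negPoch m ^ 2 * invPoch a ^ 2 *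
      invPoch b ^ 2) * ((1 - X ^ (K + 1)) * (1 - 6 * ((K : ℤ⟦X⟧) + 1)
      - 4 * (lambert b - lambert a)) + 2 * X ^ (K + 1)) := by
  subst hm hb; rfl

lemma evenStep_eq {a N m b : ℕ} (hm : m = a + 1 + N) (hb : b = a + 1 + 2 * N) :
    evenStep a N = X ^ (pent N + N + 1 + m) * (poch (2 * m) * negPoch m ^ 2) *
    (invPoch (a + 1) * invPoch b * invPoch a * invPoch (b + 1) *
      (6 * (N : ℤ⟦X⟧) + 3 + 2 * ((lambert (b + 1) - lambert a)
        + (lambert b - lambert (a + 1)))) +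
    (1 - X ^ (2 * m + 1)) * invPoch (a + 1) ^ 2 * invPoch (b + 1) ^ 2 *
      (1 + X ^ (m + 1)) * (6 * (N : ℤ⟦X⟧) + 3 + 4 * (lambert (b + 1) - lambert (a + 1)))) := by
  subst hm hb
  rw [evenStep, show a + 2 + 2 * N = a + 1 + 2 * N + 1 by ring]

lemma oddTerm_eq {a K m b : ℕ} (hm : m = a + K) (hb : b = a + 2 * K + 1) :
    oddTerm a K = X ^ pent K * (poch (2 * m + 1) * negPoch m ^ 2 * invPoch a ^ 2 *
      invPoch b ^ 2) * ((1 - X ^ (2 * K + 1)) * (6 * (K : ℤ⟦X⟧) + 1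
      + 4 * (lambert b - lambert a)) - 4 * X ^ (2 * K + 1)) := by
  subst hm hb; rfl

lemma oddStep_eq {a N m b : ℕ} (hm : m = a + 1 + N) (hb : b = a + 2 + 2 * N) :
    oddStep a N = X ^ (pent N + 2 * N + 2 + m) * (poch (2 * m + 1) * negPoch m ^ 2) *
    (invPoch (a + 1) * invPoch b * invPoch a * invPoch (b + 1) *
      (6 * (N : ℤ⟦X⟧) + 5 + (6 * (N : ℤ⟦X⟧) + 7) * X ^ (N + 1) + (1 + X ^ (N + 1)) *
        (2 * ((lambert (b + 1) - lambert a) + (lambert b - lambert (a + 1))))) +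
    (1 - X ^ (2 * m + 2)) * invPoch (a + 1) ^ 2 * invPoch (b + 1) ^ 2 *
      (1 + X ^ (m + 1)) * (6 * (N : ℤ⟦X⟧) + 5 + (6 * (N : ℤ⟦X⟧) + 7) * X ^ (N + 1)
        + (1 + X ^ (N + 1)) * (4 * (lambert (b + 1) - lambert (a + 1))))) := by
  subst hm hb
  rw [oddStep, show a + 3 + 2 * N = a + 2 + 2 * N + 1 by ring]

/-- A WZ pair: both steps on the right belong to the same order a + K + 2, so summing over K at
fixed order telescopes. -/
lemma evenTerm_sub (a K : ℕ) :
    evenTerm (a + 1 + 1) K - evenTerm (a + 1) K = evenStep a (K + 1) - evenStep (a + 1) K := by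
  obtain ⟨m, hm⟩ : ∃ m, m = a + K + 2 := ⟨_, rfl⟩
  obtain ⟨b, hb⟩ : ∃ b, b = a + 2 * K + 2 := ⟨_, rfl⟩
  -- All products and Lambert sums are brought to the common lengths m, a + 1 and b + 1. In the
  -- fraction field `geom` becomes a true inverse, and what remains of the products can be treated
  -- as free variables.
  rw [evenTerm_eq (m := m + 1) (b := b + 1 + 1) (by omega) (by omega),
    evenTerm_eq (m := m) (b := b + 1) (by omega) (by omega),
    evenStep_eq (m := m) (b := b + 1) (by omega) (by omega),
    evenStep_eq (m := m) (b := b) (by omega) (by omega), poch_double_succ, negPoch_succ,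
    invPoch_succ (a + 1), invPoch_succ (b + 1), invPoch_eq a, invPoch_eq b, lambert_succ (a + 1),
    lambert_succ (b + 1), lambert_eq a, lambert_eq b, pent_succ]
  apply IsFractionRing.injective ℤ⟦X⟧ (FractionRing ℤ⟦X⟧)
  have h₁ := one_sub_X_pow_ne_zero a
  have h₂ := one_sub_X_pow_ne_zero (a + 1)
  have h₃ := one_sub_X_pow_ne_zero b
  have h₄ := one_sub_X_pow_ne_zero (b + 1)
  simp only [map_sub, map_mul, map_add, map_pow, map_ofNat, map_one, map_natCast, algebraMap_geom,
    Nat.cast_add, Nat.cast_one]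
  generalize algebraMap ℤ⟦X⟧ (FractionRing ℤ⟦X⟧) X = q at *
  generalize algebraMap ℤ⟦X⟧ (FractionRing ℤ⟦X⟧) (poch (2 * m)) = P
  generalize algebraMap ℤ⟦X⟧ (FractionRing ℤ⟦X⟧) (negPoch m) = N
  generalize algebraMap ℤ⟦X⟧ (FractionRing ℤ⟦X⟧) (invPoch (a + 1)) = I
  generalize algebraMap ℤ⟦X⟧ (FractionRing ℤ⟦X⟧) (invPoch (b + 1)) = J
  generalize algebraMap ℤ⟦X⟧ (FractionRing ℤ⟦X⟧) (lambert (a + 1)) = L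
  generalize algebraMap ℤ⟦X⟧ (FractionRing ℤ⟦X⟧) (lambert (b + 1)) = M
  subst hm hb
  have := even_core q (q ^ a * q) (q ^ K * q) (K + 1) (M - L) (by convert h₁ using 1; ring)
    (by convert h₂ using 1; ring) (by convert h₃ using 1; ring) (by convert h₄ using 1; ring)
  linear_combination q ^ (pent K + 2 * K + 1) * P * N ^ 2 * I ^ 2 * J ^ 2 * this

/-- The end of the telescoping, at the largest index present: when the order grows, the last old
term changes and one new term with a = 0 appears. -/
lemma evenTerm_last (K : ℕ) :
    evenTerm (0 + 1) K - evenTerm 0 K + evenStep 0 K + evenTerm 0 (K + 1) = 0 := by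
  obtain ⟨m, hm⟩ : ∃ m, m = K + 1 := ⟨_, rfl⟩
  obtain ⟨b, hb⟩ : ∃ b, b = 2 * K + 1 := ⟨_, rfl⟩
  rw [evenTerm_eq (m := m + 1) (b := b + 1 + 1) (by omega) (by omega),
    evenTerm_eq (m := m) (b := b + 1) (by omega) (by omega),
    evenTerm_eq (m := m + 1) (b := b + 1 + 1 + 1) (by omega) (by omega),
    evenStep_eq (m := m) (b := b) (by omega) (by omega), poch_double_succ, negPoch_succ,
    invPoch_succ 0, invPoch_succ (b + 1 + 1), invPoch_succ (b + 1), invPoch_eq b, lambert_succ 0,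
    lambert_succ (b + 1 + 1), lambert_succ (b + 1), lambert_eq b, pent_succ, invPoch_zero,
    lambert_zero]
  apply IsFractionRing.injective ℤ⟦X⟧ (FractionRing ℤ⟦X⟧)
  have h₂ := one_sub_X_pow_ne_zero 0
  have h₃ := one_sub_X_pow_ne_zero b
  have h₄ := one_sub_X_pow_ne_zero (b + 1)
  have h₅ := one_sub_X_pow_ne_zero (b + 1 + 1)
  simp only [map_sub, map_mul, map_add, map_pow, map_ofNat, map_one, map_natCast, map_zero, map_neg, algebraMap_geom,
    Nat.cast_add, Nat.cast_one, Nat.cast_zero]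
  generalize algebraMap ℤ⟦X⟧ (FractionRing ℤ⟦X⟧) X = q at *
  generalize algebraMap ℤ⟦X⟧ (FractionRing ℤ⟦X⟧) (poch (2 * m)) = P
  generalize algebraMap ℤ⟦X⟧ (FractionRing ℤ⟦X⟧) (negPoch m) = N
  generalize algebraMap ℤ⟦X⟧ (FractionRing ℤ⟦X⟧) (invPoch (b + 1)) = J
  generalize algebraMap ℤ⟦X⟧ (FractionRing ℤ⟦X⟧) (lambert (b + 1)) = M
  subst hm hb
  have := even_core_last q (q ^ K * q) (K + 1) M (by convert h₂ using 1; ring)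
    (by convert h₃ using 1; ring) (by convert h₄ using 1; ring) (by convert h₅ using 1; ring)
  linear_combination q ^ (pent K + 2 * K + 1) * P * N ^ 2 * J ^ 2 * this

/-- The start of the telescoping: index 0 stands alone and contributes the step at N = 0. -/
lemma evenCenter_sub (a : ℕ) :
    evenCenter (a + 1 + 1) - evenCenter (a + 1) = evenStep a 0 := by
  rw [evenStep_eq (m := a + 1) (b := a + 1) (by omega) (by omega), evenCenter, evenCenter,
    poch_double_succ, negPoch_succ, invPoch_succ (a + 1), invPoch_eq a, lambert_succ (a + 1),
    lambert_eq a, show pent 0 = 0 from rfl]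
  apply IsFractionRing.injective ℤ⟦X⟧ (FractionRing ℤ⟦X⟧)
  have h₁ := one_sub_X_pow_ne_zero a
  have h₂ := one_sub_X_pow_ne_zero (a + 1)
  simp only [map_sub, map_mul, map_add, map_pow, map_ofNat, map_one, map_natCast, map_zero, map_neg, algebraMap_geom,
    Nat.cast_add, Nat.cast_one, Nat.cast_zero]
  generalize algebraMap ℤ⟦X⟧ (FractionRing ℤ⟦X⟧) X = q at *
  generalize algebraMap ℤ⟦X⟧ (FractionRing ℤ⟦X⟧) (poch (2 * (a + 1))) = P
  generalize algebraMap ℤ⟦X⟧ (FractionRing ℤ⟦X⟧) (negPoch (a + 1)) = N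
  generalize algebraMap ℤ⟦X⟧ (FractionRing ℤ⟦X⟧) (invPoch (a + 1)) = I
  generalize algebraMap ℤ⟦X⟧ (FractionRing ℤ⟦X⟧) (lambert (a + 1)) = L
  simp only [show q ^ (a + 1 + 1) = q * q ^ (a + 1) by ring,
    show q ^ (2 * (a + 1) + 1) = q * (q ^ (a + 1)) ^ 2 by ring,
    show q ^ (2 * (a + 1) + 2) = q ^ 2 * (q ^ (a + 1)) ^ 2 by ring,
    show q ^ (0 + 0 + 1 + (a + 1)) = q * q ^ (a + 1) by ring] at *
  generalize q ^ (a + 1) = x at *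
  field_simp
  ring

lemma evenCenter_last : evenCenter (0 + 1) + evenTerm 0 0 = 1 := by
  rw [evenTerm_eq (m := 0 + 1) (b := 0 + 1 + 1) (by omega) (by omega), evenCenter,
    poch_double_succ, negPoch_succ, invPoch_succ (0 + 1), invPoch_succ 0,
    lambert_succ (0 + 1), lambert_succ 0, show pent 0 = 0 from rfl, mul_zero, poch_zero,
    negPoch_zero, invPoch_zero, lambert_zero]
  apply IsFractionRing.injective ℤ⟦X⟧ (FractionRing ℤ⟦X⟧)
  have h₁ := one_sub_X_pow_ne_zero 0
  have h₂ := one_sub_X_pow_ne_zero (0 + 1)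
  simp only [map_sub, map_mul, map_add, map_pow, map_ofNat, map_one, map_natCast, map_zero, map_neg, algebraMap_geom,
    Nat.cast_add, Nat.cast_one, Nat.cast_zero]
  generalize algebraMap ℤ⟦X⟧ (FractionRing ℤ⟦X⟧) X = q at *
  simp only [zero_add, pow_one] at *
  norm_num at *
  field_simp
  ring

lemma oddTerm_sub (a K : ℕ) :
    oddTerm (a + 1 + 1) (K + 1) - oddTerm (a + 1) (K + 1) = oddStep (a + 1) K - oddStep a (K + 1) := by
  obtain ⟨m, hm⟩ : ∃ m, m = a + K + 2 := ⟨_, rfl⟩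
  obtain ⟨b, hb⟩ : ∃ b, b = a + 2 * K + 3 := ⟨_, rfl⟩
  rw [oddTerm_eq (m := m + 1) (b := b + 1 + 1) (by omega) (by omega),
    oddTerm_eq (m := m) (b := b + 1) (by omega) (by omega),
    oddStep_eq (m := m) (b := b) (by omega) (by omega),
    oddStep_eq (m := m) (b := b + 1) (by omega) (by omega), poch_double_succ_add_one, negPoch_succ,
    invPoch_succ (a + 1), invPoch_succ (b + 1), invPoch_eq a, invPoch_eq b, lambert_succ (a + 1),
    lambert_succ (b + 1), lambert_eq a, lambert_eq b, pent_succ]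
  apply IsFractionRing.injective ℤ⟦X⟧ (FractionRing ℤ⟦X⟧)
  have h₁ := one_sub_X_pow_ne_zero a
  have h₂ := one_sub_X_pow_ne_zero (a + 1)
  have h₃ := one_sub_X_pow_ne_zero b
  have h₄ := one_sub_X_pow_ne_zero (b + 1)
  simp only [map_sub, map_mul, map_add, map_pow, map_ofNat, map_one, map_natCast, map_zero, map_neg, algebraMap_geom,
    Nat.cast_add, Nat.cast_one, Nat.cast_zero]
  generalize algebraMap ℤ⟦X⟧ (FractionRing ℤ⟦X⟧) X = q at *
  generalize algebraMap ℤ⟦X⟧ (FractionRing ℤ⟦X⟧) (poch (2 * m + 1)) = P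
  generalize algebraMap ℤ⟦X⟧ (FractionRing ℤ⟦X⟧) (negPoch m) = N
  generalize algebraMap ℤ⟦X⟧ (FractionRing ℤ⟦X⟧) (invPoch (a + 1)) = I
  generalize algebraMap ℤ⟦X⟧ (FractionRing ℤ⟦X⟧) (invPoch (b + 1)) = J
  generalize algebraMap ℤ⟦X⟧ (FractionRing ℤ⟦X⟧) (lambert (a + 1)) = L
  generalize algebraMap ℤ⟦X⟧ (FractionRing ℤ⟦X⟧) (lambert (b + 1)) = M
  subst hm hb
  have := odd_core q (q ^ a * q) (q ^ K * q) (K + 1) (M - L) (by convert h₁ using 1; ring)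
    (by convert h₂ using 1; ring) (by convert h₃ using 1; ring) (by convert h₄ using 1; ring)
  linear_combination q ^ (pent K + 3 * K + 2) * P * N ^ 2 * I ^ 2 * J ^ 2 * this

/-- The start of the odd telescoping, where no lower step occurs. -/
lemma oddTerm_zero_sub (a : ℕ) :
    oddTerm (a + 1 + 1) 0 - oddTerm (a + 1) 0 = -oddStep a 0 := by
  rw [oddTerm_eq (m := a + 1 + 1) (b := a + 1 + 1 + 1) (by omega) (by omega),
    oddTerm_eq (m := a + 1) (b := a + 1 + 1) (by omega) (by omega),
    oddStep_eq (m := a + 1) (b := a + 1 + 1) (by omega) (by omega), poch_double_succ_add_one,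
    negPoch_succ (a + 1), invPoch_eq a, invPoch_succ (a + 1 + 1), invPoch_eq (a + 1),
    lambert_succ (a + 1 + 1), lambert_succ (a + 1), lambert_eq a, show pent 0 = 0 from rfl]
  apply IsFractionRing.injective ℤ⟦X⟧ (FractionRing ℤ⟦X⟧)
  have h₁ := one_sub_X_pow_ne_zero a
  have h₂ := one_sub_X_pow_ne_zero (a + 1)
  have h₃ := one_sub_X_pow_ne_zero (a + 1 + 1)
  simp only [map_sub, map_mul, map_add, map_pow, map_ofNat, map_one, map_natCast, map_zero, map_neg, algebraMap_geom,
    Nat.cast_add, Nat.cast_one, Nat.cast_zero]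
  generalize algebraMap ℤ⟦X⟧ (FractionRing ℤ⟦X⟧) X = q at *
  generalize algebraMap ℤ⟦X⟧ (FractionRing ℤ⟦X⟧) (poch (2 * (a + 1) + 1)) = P
  generalize algebraMap ℤ⟦X⟧ (FractionRing ℤ⟦X⟧) (negPoch (a + 1)) = N
  generalize algebraMap ℤ⟦X⟧ (FractionRing ℤ⟦X⟧) (invPoch (a + 1 + 1)) = J
  generalize algebraMap ℤ⟦X⟧ (FractionRing ℤ⟦X⟧) (lambert (a + 1)) = L
  simp only [show q ^ (a + 1 + 1) = q * q ^ (a + 1) by ring,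
    show q ^ (a + 1 + 1 + 1) = q ^ 2 * q ^ (a + 1) by ring,
    show q ^ (2 * (a + 1) + 2) = q ^ 2 * (q ^ (a + 1)) ^ 2 by ring,
    show q ^ (2 * (a + 1) + 3) = q ^ 3 * (q ^ (a + 1)) ^ 2 by ring,
    show q ^ (0 + 2 * 0 + 2 + (a + 1)) = q ^ 2 * q ^ (a + 1) by ring] at *
  generalize q ^ (a + 1) = x at *
  field_simp
  ring

lemma oddTerm_last (K : ℕ) :
    oddTerm (0 + 1) (K + 1) - oddTerm 0 (K + 1) - oddStep 0 K + oddTerm 0 (K + 1 + 1) = 0 := by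
  obtain ⟨m, hm⟩ : ∃ m, m = K + 1 := ⟨_, rfl⟩
  obtain ⟨b, hb⟩ : ∃ b, b = 2 * K + 2 := ⟨_, rfl⟩
  rw [oddTerm_eq (m := m + 1) (b := b + 1 + 1) (by omega) (by omega),
    oddTerm_eq (m := m) (b := b + 1) (by omega) (by omega),
    oddTerm_eq (m := m + 1) (b := b + 1 + 1 + 1) (by omega) (by omega),
    oddStep_eq (m := m) (b := b) (by omega) (by omega), poch_double_succ_add_one, negPoch_succ,
    invPoch_succ 0, invPoch_succ (b + 1 + 1), invPoch_succ (b + 1), invPoch_eq b, lambert_succ 0,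
    lambert_succ (b + 1 + 1), lambert_succ (b + 1), lambert_eq b, invPoch_zero,
    lambert_zero]
  simp only [pent_succ]
  apply IsFractionRing.injective ℤ⟦X⟧ (FractionRing ℤ⟦X⟧)
  have h₂ := one_sub_X_pow_ne_zero 0
  have h₃ := one_sub_X_pow_ne_zero b
  have h₄ := one_sub_X_pow_ne_zero (b + 1)
  have h₅ := one_sub_X_pow_ne_zero (b + 1 + 1)
  simp only [map_sub, map_mul, map_add, map_pow, map_ofNat, map_one, map_natCast, map_zero, map_neg, algebraMap_geom,
    Nat.cast_add, Nat.cast_one, Nat.cast_zero]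
  generalize algebraMap ℤ⟦X⟧ (FractionRing ℤ⟦X⟧) X = q at *
  generalize algebraMap ℤ⟦X⟧ (FractionRing ℤ⟦X⟧) (poch (2 * m + 1)) = P
  generalize algebraMap ℤ⟦X⟧ (FractionRing ℤ⟦X⟧) (negPoch m) = N
  generalize algebraMap ℤ⟦X⟧ (FractionRing ℤ⟦X⟧) (invPoch (b + 1)) = J
  generalize algebraMap ℤ⟦X⟧ (FractionRing ℤ⟦X⟧) (lambert (b + 1)) = M
  subst hm hb
  have := odd_core_last q (q ^ K * q) (K + 1) M (by convert h₂ using 1; ring)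
    (by convert h₃ using 1; ring) (by convert h₄ using 1; ring) (by convert h₅ using 1; ring)
  linear_combination q ^ (pent K + 3 * K + 2) * P * N ^ 2 * J ^ 2 * this

lemma oddTerm_zero_zero : oddTerm 0 0 = 1 := by
  rw [oddTerm_eq (m := 0) (b := 0 + 1) (by omega) (by omega), mul_zero, poch_succ, invPoch_succ,
    lambert_succ, show pent 0 = 0 from rfl, poch_zero, negPoch_zero, invPoch_zero, lambert_zero]
  apply IsFractionRing.injective ℤ⟦X⟧ (FractionRing ℤ⟦X⟧)
  have h₁ := one_sub_X_pow_ne_zero 0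
  simp only [map_sub, map_mul, map_add, map_pow, map_ofNat, map_one, map_natCast, map_zero, map_neg, algebraMap_geom,
    Nat.cast_add, Nat.cast_one, Nat.cast_zero]
  generalize algebraMap ℤ⟦X⟧ (FractionRing ℤ⟦X⟧) X = q at *
  simp only [zero_add, pow_one] at *
  norm_num at *
  field_simp
  ring

lemma oddTerm_zero_last : oddTerm 1 0 + oddTerm 0 1 = 1 := by
  -- The analogue of `oddTerm_last` for the first pair; no step occurs because the telescoping
  -- begins here.
  have e : oddTerm 1 0 - oddTerm 0 0 + oddTerm 0 1 = 0 := by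
    rw [oddTerm_eq (m := 0 + 1) (b := 0 + 1 + 1) (by omega) (by omega),
      oddTerm_eq (m := 0) (b := 0 + 1) (by omega) (by omega),
      oddTerm_eq (m := 0 + 1) (b := 0 + 1 + 1 + 1) (by omega) (by omega), poch_double_succ_add_one,
      negPoch_succ, invPoch_succ (0 + 1 + 1), invPoch_succ (0 + 1), invPoch_succ 0,
      lambert_succ (0 + 1 + 1), lambert_succ (0 + 1), lambert_succ 0, mul_zero, poch_succ 0,
      show pent 0 = 0 from rfl, show pent 1 = 2 from rfl, poch_zero, negPoch_zero, invPoch_zero,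
      lambert_zero]
    apply IsFractionRing.injective ℤ⟦X⟧ (FractionRing ℤ⟦X⟧)
    have h₂ := one_sub_X_pow_ne_zero 0
    have h₃ := one_sub_X_pow_ne_zero (0 + 1)
    have h₄ := one_sub_X_pow_ne_zero (0 + 1 + 1)
    simp only [map_sub, map_mul, map_add, map_pow, map_ofNat, map_one, map_natCast, map_zero, map_neg, algebraMap_geom,
      Nat.cast_add, Nat.cast_one, Nat.cast_zero]
    generalize algebraMap ℤ⟦X⟧ (FractionRing ℤ⟦X⟧) X = q at *
    simp only [zero_add, pow_one] at *
    norm_num at *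
    field_simp
    ring
  linear_combination e + oddTerm_zero_zero

/-! ### Signs of the increments and of the omitted terms -/

/-- With m = a + 1 + N, the lengths of two inverse products add up to 2m in the first summand and to
2m + 1 in the second, where the factor 1 - q^(2m+1) extends the numerator. Each summand is thus a
Gaussian binomial times visibly nonnegative factors. -/
lemma evenStep_mem (a N : ℕ) : evenStep a N ∈ nonnegCoeff := by
  have e : evenStep a N = X ^ (pent N + N + 1 + (a + 1 + N)) * negPoch (a + 1 + N) ^ 2 *
      ((poch ((a + 1) + (a + 1 + 2 * N)) * invPoch (a + 1) * invPoch (a + 1 + 2 * N)) *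
        invPoch a * invPoch (a + 2 + 2 * N) * (((6 * N + 3 : ℕ) : ℤ⟦X⟧)
          + ((2 : ℕ) : ℤ⟦X⟧) * ((lambert (a + 2 + 2 * N) - lambert a)
          + (lambert (a + 1 + 2 * N) - lambert (a + 1)))) +
      (poch ((a + 1) + (a + 2 + 2 * N)) * invPoch (a + 1) * invPoch (a + 2 + 2 * N)) *
        invPoch (a + 1) * invPoch (a + 2 + 2 * N) * (1 + X ^ (a + 1 + N + 1)) *
        (((6 * N + 3 : ℕ) : ℤ⟦X⟧)
          + ((4 : ℕ) : ℤ⟦X⟧) * (lambert (a + 2 + 2 * N) - lambert (a + 1)))) := by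
    rw [evenStep, show (a + 1) + (a + 1 + 2 * N) = 2 * (a + 1 + N) by ring,
      show (a + 1) + (a + 2 + 2 * N) = 2 * (a + 1 + N) + 1 by ring, poch_succ]
    push_cast
    ring
  rw [e]
  have h₁ := poch_mul_invPoch_mul_invPoch_mem (a + 1) (a + 1 + 2 * N)
  have h₂ := poch_mul_invPoch_mul_invPoch_mem (a + 1) (a + 2 + 2 * N)
  have l₁ := lambert_sub_mem (show a ≤ a + 2 + 2 * N by omega)
  have l₂ := lambert_sub_mem (show a + 1 ≤ a + 1 + 2 * N by omega)
  have l₃ := lambert_sub_mem (show a + 1 ≤ a + 2 + 2 * N by omega)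
  exact mul_mem (mul_mem (X_pow_mem _) (pow_mem (negPoch_mem _) _)) (add_mem
    (mul_mem (mul_mem (mul_mem h₁ (invPoch_mem _)) (invPoch_mem _))
      (add_mem (natCast_mem _ _) (mul_mem (natCast_mem _ _) (add_mem l₁ l₂))))
    (mul_mem (mul_mem (mul_mem (mul_mem h₂ (invPoch_mem _)) (invPoch_mem _))
      (add_mem (one_mem _) (X_pow_mem _)))
      (add_mem (natCast_mem _ _) (mul_mem (natCast_mem _ _) l₃))))

lemma oddStep_mem (a N : ℕ) : oddStep a N ∈ nonnegCoeff := by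
  have e : oddStep a N = X ^ (pent N + 2 * N + 2 + (a + 1 + N)) * negPoch (a + 1 + N) ^ 2 *
      ((poch ((a + 1) + (a + 2 + 2 * N)) * invPoch (a + 1) * invPoch (a + 2 + 2 * N)) *
        invPoch a * invPoch (a + 3 + 2 * N) * ((((6 * N + 5 : ℕ) : ℤ⟦X⟧)
          + ((6 * N + 7 : ℕ) : ℤ⟦X⟧) * X ^ (N + 1))
          + (1 + X ^ (N + 1)) * (((2 : ℕ) : ℤ⟦X⟧) * ((lambert (a + 3 + 2 * N) - lambert a)
          + (lambert (a + 2 + 2 * N) - lambert (a + 1))))) +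
      (poch ((a + 1) + (a + 3 + 2 * N)) * invPoch (a + 1) * invPoch (a + 3 + 2 * N)) *
        invPoch (a + 1) * invPoch (a + 3 + 2 * N) * (1 + X ^ (a + 1 + N + 1)) *
        ((((6 * N + 5 : ℕ) : ℤ⟦X⟧) + ((6 * N + 7 : ℕ) : ℤ⟦X⟧) * X ^ (N + 1))
          + (1 + X ^ (N + 1)) * (((4 : ℕ) : ℤ⟦X⟧) *
            (lambert (a + 3 + 2 * N) - lambert (a + 1))))) := by
    rw [oddStep, show (a + 1) + (a + 2 + 2 * N) = 2 * (a + 1 + N) + 1 by ring,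
      show (a + 1) + (a + 3 + 2 * N) = 2 * (a + 1 + N) + 1 + 1 by ring,
      poch_succ (2 * (a + 1 + N) + 1)]
    push_cast
    ring
  rw [e]
  have h₁ := poch_mul_invPoch_mul_invPoch_mem (a + 1) (a + 2 + 2 * N)
  have h₂ := poch_mul_invPoch_mul_invPoch_mem (a + 1) (a + 3 + 2 * N)
  have l₁ := lambert_sub_mem (show a ≤ a + 3 + 2 * N by omega)
  have l₂ := lambert_sub_mem (show a + 1 ≤ a + 2 + 2 * N by omega)
  have l₃ := lambert_sub_mem (show a + 1 ≤ a + 3 + 2 * N by omega)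
  have p : ((6 * N + 5 : ℕ) : ℤ⟦X⟧) + ((6 * N + 7 : ℕ) : ℤ⟦X⟧) * X ^ (N + 1) ∈ nonnegCoeff :=
    add_mem (natCast_mem _ _) (mul_mem (natCast_mem _ _) (X_pow_mem _))
  have x (n : ℕ) : (1 : ℤ⟦X⟧) + X ^ n ∈ nonnegCoeff := add_mem (one_mem _) (X_pow_mem _)
  exact mul_mem (mul_mem (X_pow_mem _) (pow_mem (negPoch_mem _) _)) (add_mem
    (mul_mem (mul_mem (mul_mem h₁ (invPoch_mem _)) (invPoch_mem _))
      (add_mem p (mul_mem (x _) (mul_mem (natCast_mem _ _) (add_mem l₁ l₂)))))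
    (mul_mem (mul_mem (mul_mem (mul_mem h₂ (invPoch_mem _)) (invPoch_mem _)) (x _))
      (add_mem p (mul_mem (x _) (mul_mem (natCast_mem _ _) l₃)))))

/-- At a = 0 the numerator cancels one inverse product. The Lambert summand q^(N+1)/(1 - q^(N+1)),
multiplied by 4(1 - q^(N+1)), gives 4q^(N+1), which outweighs the only negative contribution
-2q^(N+1). -/
lemma neg_evenTerm_zero_mem (N : ℕ) : -evenTerm 0 N ∈ nonnegCoeff := by
  obtain ⟨b, hb⟩ : ∃ b, b = 2 * N + 2 := ⟨_, rfl⟩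
  have e : -evenTerm 0 N = X ^ (pent N + 2 * N + 1) * negPoch (N + 1) ^ 2 *
      ((1 - X ^ (N + 1)) * invPoch b * (((6 * N + 5 : ℕ) : ℤ⟦X⟧)
        + ((4 : ℕ) : ℤ⟦X⟧) * (lambert b - X ^ (N + 1) * geom N))
      + ((2 : ℕ) : ℤ⟦X⟧) * (invPoch b * X ^ (N + 1))) := by
    rw [evenTerm_eq (m := N + 1) (b := b) (by omega) (by omega),
      show 2 * (N + 1) = b by omega, invPoch_zero, lambert_zero]
    push_cast
    linear_combination -X ^ (pent N + 2 * N + 1) * negPoch (N + 1) ^ 2 * invPoch b *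
      ((1 - X ^ (N + 1)) * (1 - 6 * ((N : ℤ⟦X⟧) + 1) - 4 * lambert b) + 2 * X ^ (N + 1)) *
        poch_mul_invPoch b + 4 * X ^ (pent N + 2 * N + 1) * negPoch (N + 1) ^ 2 * invPoch b *
        X ^ (N + 1) * one_sub_mul_geom N
  rw [e]
  exact mul_mem (mul_mem (X_pow_mem _) (pow_mem (negPoch_mem _) _)) (add_mem
    (mul_mem (one_sub_mul_invPoch_mem (by omega)) (add_mem (natCast_mem _ _)
      (mul_mem (natCast_mem _ _) (lambert_sub_term_mem (by omega)))))
    (mul_mem (natCast_mem _ _) (mul_mem (invPoch_mem _) (X_pow_mem _))))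

/-- Here the Lambert summand with exponent 2N + 1 cancels -4q^(2N+1) exactly. -/
lemma oddTerm_zero_mem (N : ℕ) : oddTerm 0 N ∈ nonnegCoeff := by
  have e : oddTerm 0 N = X ^ pent N * negPoch N ^ 2 *
      ((1 - X ^ (2 * N + 1)) * invPoch (2 * N + 1) * (((6 * N + 1 : ℕ) : ℤ⟦X⟧)
        + ((4 : ℕ) : ℤ⟦X⟧) * (lambert (2 * N + 1) - X ^ (2 * N + 1) * geom (2 * N)))) := by
    rw [oddTerm_eq (m := N) (b := 2 * N + 1) (by omega) (by omega), invPoch_zero, lambert_zero]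
    push_cast
    linear_combination X ^ pent N * negPoch N ^ 2 * invPoch (2 * N + 1) *
      ((1 - X ^ (2 * N + 1)) * (6 * (N : ℤ⟦X⟧) + 1 + 4 * lambert (2 * N + 1))
        - 4 * X ^ (2 * N + 1)) * poch_mul_invPoch (2 * N + 1)
      + 4 * X ^ pent N * negPoch N ^ 2 * invPoch (2 * N + 1) *
        X ^ (2 * N + 1) * one_sub_mul_geom (2 * N)
  rw [e]
  exact mul_mem (mul_mem (X_pow_mem _) (pow_mem (negPoch_mem _) _))
    (mul_mem (one_sub_mul_invPoch_mem (by omega)) (add_mem (natCast_mem _ _)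
      (mul_mem (natCast_mem _ _) (lambert_sub_term_mem (by omega)))))

/-! ### Finite forms and their monotonicity in the order -/

/-- The finite form of order `m` of the truncation to the indices `-N, …, N`. -/
noncomputable def evenTrunc (m N : ℕ) : ℤ⟦X⟧ :=
  evenCenter m + ∑ K ∈ Finset.range N, evenTerm (m - K - 1) K

/-- The finite form of order `m` of the truncation to the indices `-N - 1, …, N`. -/
noncomputable def oddTrunc (m N : ℕ) : ℤ⟦X⟧ := ∑ K ∈ Finset.range (N + 1), oddTerm (m - K) K

lemma evenTrunc_succ (m N : ℕ) :
    evenTrunc m (N + 1) = evenTrunc m N + evenTerm (m - N - 1) N := by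
  rw [evenTrunc, Finset.sum_range_succ, ← add_assoc, evenTrunc]

lemma oddTrunc_succ (m N : ℕ) :
    oddTrunc m (N + 1) = oddTrunc m N + oddTerm (m - (N + 1)) (N + 1) :=
  Finset.sum_range_succ ..

lemma oddTrunc_zero (m : ℕ) : oddTrunc m 0 = oddTerm m 0 := by simp [oddTrunc]

/-- The sum of `evenCenter_sub` and `evenTerm_sub` over the indices; the induction trades N + 1 for
a + 1, which keeps the order fixed. -/
lemma evenTrunc_sub (a N : ℕ) :
    evenTrunc (a + 2 + N) N - evenTrunc (a + 1 + N) N = evenStep a N := by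
  induction N generalizing a with
  | zero => simpa [evenTrunc] using evenCenter_sub a
  | succ N ih =>
    have := ih (a + 1)
    rw [show a + 1 + 2 + N = a + 2 + (N + 1) by ring,
      show a + 1 + 1 + N = a + 1 + (N + 1) by ring] at this
    rw [evenTrunc_succ, evenTrunc_succ, show a + 2 + (N + 1) - N - 1 = a + 1 + 1 by omega,
      show a + 1 + (N + 1) - N - 1 = a + 1 by omega]
    linear_combination this + evenTerm_sub a N

lemma oddTrunc_sub (a N : ℕ) :
    oddTrunc (a + 2 + N) N - oddTrunc (a + 1 + N) N = -oddStep a N := by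
  induction N generalizing a with
  | zero => simpa [oddTrunc_zero] using oddTerm_zero_sub a
  | succ N ih =>
    have := ih (a + 1)
    rw [show a + 1 + 2 + N = a + 2 + (N + 1) by ring,
      show a + 1 + 1 + N = a + 1 + (N + 1) by ring] at this
    rw [oddTrunc_succ, oddTrunc_succ, show a + 2 + (N + 1) - (N + 1) = a + 1 + 1 by omega,
      show a + 1 + (N + 1) - (N + 1) = a + 1 by omega]
    linear_combination this + oddTerm_sub a N

/-- A finite form of the quintuple product identity, divided by `1 - z`, at `z = 1`. -/
lemma evenTrunc_self (N : ℕ) : evenTrunc N N = 1 := by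
  induction N with
  | zero => simp [evenTrunc, evenCenter]
  | succ N ih =>
    rw [evenTrunc_succ, show N + 1 - N - 1 = 0 by omega]
    cases N with
    | zero => simpa [evenTrunc] using evenCenter_last
    | succ K =>
      -- From order K + 1 to K + 2, the indices below the last contribute `evenStep 0 K`;
      -- `evenTerm_last` cancels this against the change of the last term and the new one.
      have := evenTrunc_sub 0 K
      rw [show 0 + 2 + K = K + 1 + 1 by ring, show 0 + 1 + K = K + 1 by ring] at this
      rw [evenTrunc_succ, show K + 1 - K - 1 = 0 by omega] at ih
      rw [evenTrunc_succ, show K + 1 + 1 - K - 1 = 0 + 1 by omega]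
      linear_combination this + ih + evenTerm_last K

/-- A finite form of the quintuple product identity, divided by `1 - z`, at `z = 1`. -/
lemma oddTrunc_self (N : ℕ) : oddTrunc N N = 1 := by
  induction N with
  | zero => rw [oddTrunc_zero, oddTerm_zero_zero]
  | succ N ih =>
    rw [oddTrunc_succ, Nat.sub_self]
    cases N with
    | zero => rw [oddTrunc_zero]; exact oddTerm_zero_last
    | succ K =>
      have := oddTrunc_sub 0 K
      rw [show 0 + 2 + K = K + 1 + 1 by ring, show 0 + 1 + K = K + 1 by ring] at this
      rw [oddTrunc_succ, Nat.sub_self] at ih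
      rw [oddTrunc_succ, show K + 1 + 1 - (K + 1) = 0 + 1 by omega]
      linear_combination this + ih + oddTerm_last K

/-- At order N + 1 the difference is exactly the omitted outer pair with its sign reversed; each
later order adds an `evenStep`. -/
lemma evenTrunc_sub_one_mem {m N : ℕ} (h : N + 1 ≤ m) : evenTrunc m N - 1 ∈ nonnegCoeff := by
  induction m, h using Nat.le_induction with
  | base =>
    have := evenTrunc_self (N + 1)
    rw [evenTrunc_succ, show N + 1 - N - 1 = 0 by omega] at this
    rw [← this, sub_add_cancel_left]
    exact neg_evenTerm_zero_mem N
  | succ m hm ih =>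
    obtain ⟨a, rfl⟩ := Nat.exists_eq_add_of_le hm
    have := evenTrunc_sub a N
    rw [show a + 2 + N = N + 1 + a + 1 by ring, show a + 1 + N = N + 1 + a by ring] at this
    rw [eq_add_of_sub_eq this, add_sub_assoc]
    exact add_mem (evenStep_mem _ _) ih

lemma one_sub_oddTrunc_mem {m N : ℕ} (h : N + 1 ≤ m) : 1 - oddTrunc m N ∈ nonnegCoeff := by
  induction m, h using Nat.le_induction with
  | base =>
    have := oddTrunc_self (N + 1)
    rw [oddTrunc_succ, Nat.sub_self] at this
    rw [← this, add_sub_cancel_left]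
    exact oddTerm_zero_mem _
  | succ m hm ih =>
    obtain ⟨a, rfl⟩ := Nat.exists_eq_add_of_le hm
    have := oddTrunc_sub a N
    rw [show a + 2 + N = N + 1 + a + 1 by ring, show a + 1 + N = N + 1 + a by ring] at this
    rw [eq_add_of_sub_eq this, sub_add_eq_sub_sub, sub_neg_eq_add, add_comm, add_sub_assoc,
      add_comm, sub_add_eq_add_sub, add_comm, add_sub_assoc]
    exact add_mem (oddStep_mem _ _) ih

/-! ### Generating functions and limits of the finite forms -/

/-- The generating function of partitions. -/
noncomputable def partitionSeries : ℤ⟦X⟧ := mk fun n => (Nat.card n.Partition : ℤ)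

/-- The generating function of overpartitions. -/
noncomputable def overpartitionSeries : ℤ⟦X⟧ := mk fun n => (Nat.card (Overpartition n) : ℤ)

/-- The generating function of triplets of a partition and two overpartitions. -/
noncomputable def tripletSeries : ℤ⟦X⟧ := mk fun n => (ppp n : ℤ)

lemma card_overpartition (n : ℕ) :
    Nat.card (Overpartition n) = ∑ p : n.Partition, 2 ^ p.parts.toFinset.card := by
  let e : Overpartition n ≃ Σ p : n.Partition, p.parts.toFinset.powerset :=
    { toFun := fun o => ⟨o.toPartition, o.overlined, Finset.mem_powerset.2 o.overlined_subset⟩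
      invFun := fun s => ⟨s.1, s.2.1, Finset.mem_powerset.1 s.2.2⟩
      left_inv := fun _ => rfl
      right_inv := fun _ => rfl }
  rw [Nat.card_congr e, Nat.card_sigma]
  refine Finset.sum_congr rfl fun p _ => ?_
  rw [Nat.card_eq_fintype_card, Fintype.card_coe, Finset.card_powerset]

lemma tsum_X_pow (i : ℕ) : ∑' j : ℕ, (X : ℤ⟦X⟧) ^ ((i + 1) * (j + 1)) = X ^ (i + 1) * geom i := by
  have h0 : (X ^ (i + 1) : ℤ⟦X⟧).constantCoeff = 0 := by simp
  have hg : ∑' j : ℕ, ((X : ℤ⟦X⟧) ^ (i + 1)) ^ j = geom i := by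
    have := WithPiTopology.tsum_pow_mul_one_sub_of_constantCoeff_eq_zero h0
    linear_combination geom i * this - (∑' j : ℕ, ((X : ℤ⟦X⟧) ^ (i + 1)) ^ j) * one_sub_mul_geom i
  rw [← hg, ← (WithPiTopology.summable_pow_of_constantCoeff_eq_zero h0).tsum_mul_left]
  refine tsum_congr fun j => ?_
  ring

lemma summable_X_pow (i : ℕ) : Summable fun j : ℕ => (X : ℤ⟦X⟧) ^ ((i + 1) * (j + 1)) := by
  have h0 : (X ^ (i + 1) : ℤ⟦X⟧).constantCoeff = 0 := by simp
  refine ((WithPiTopology.summable_pow_of_constantCoeff_eq_zero h0).mul_left (X ^ (i + 1))).congr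
    fun j => ?_
  ring

lemma tendsto_invPoch : Tendsto invPoch atTop (𝓝 partitionSeries) := by
  have h := (Nat.Partition.hasProd_genFun (fun _ _ => (1 : ℤ))).tendsto_prod_nat
  convert h using 2 with n
  · refine Finset.prod_congr rfl fun i _ => ?_
    trans 1 + ∑' j, C (1 : ℤ) * X ^ ((i + 1) * (j + 1))
    · rw [(summable_X_pow i).tsum_mul_left, tsum_X_pow, map_one]
      linear_combination one_sub_mul_geom i
    · exact congrArg _ (tsum_congr fun j => (smul_eq_C_mul _ _).symm)
  · ext n
    simp [partitionSeries, Finsupp.prod]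

/-- Each distinct part size carries weight 2 (overlined or not), so its factor is 1 + 2q^i/(1 - q^i)
= (1 + q^i)/(1 - q^i). -/
lemma tendsto_negPoch_mul_invPoch :
    Tendsto (fun n => negPoch n * invPoch n) atTop (𝓝 overpartitionSeries) := by
  have h := (Nat.Partition.hasProd_genFun (fun _ _ => (2 : ℤ))).tendsto_prod_nat
  convert h using 2 with n
  · rw [negPoch, invPoch, ← Finset.prod_mul_distrib]
    refine Finset.prod_congr rfl fun i _ => ?_
    trans 1 + ∑' j, C (2 : ℤ) * X ^ ((i + 1) * (j + 1))
    · rw [(summable_X_pow i).tsum_mul_left, tsum_X_pow, map_ofNat]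
      linear_combination one_sub_mul_geom i
    · exact congrArg _ (tsum_congr fun j => (smul_eq_C_mul _ _).symm)
  · ext n
    simp [overpartitionSeries, Finsupp.prod, card_overpartition]

/-- Only convergence matters: Lambert sums enter through differences, which tend to 0. -/
lemma exists_tendsto_lambert : ∃ L, Tendsto lambert atTop (𝓝 L) := by
  have h : Summable fun j : ℕ => (X : ℤ⟦X⟧) ^ (j + 1) * geom j := by
    apply WithPiTopology.summable_of_tendsto_order_atTop_nhds_top
    refine ENat.tendsto_nhds_top_iff_natCast_lt.mpr fun n => eventually_atTop.mpr ⟨n, fun m hm => ?_⟩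
    refine lt_of_lt_of_le (b := ((m + 1 : ℕ) : ℕ∞)) (by exact_mod_cast Nat.lt_succ_of_le hm) ?_
    refine le_trans ?_ (le_order_mul _ _)
    rw [order_X_pow]
    exact le_self_add
  exact ⟨_, h.hasSum.tendsto_sum_nat⟩

lemma exists_tendsto_poch : ∃ φ, Tendsto poch atTop (𝓝 φ) ∧ φ * partitionSeries = 1 := by
  have h : Tendsto poch atTop (𝓝 (∏' n : ℕ, (1 - X ^ (n + 1) : ℤ⟦X⟧))) :=
    (WithPiTopology.multipliable_one_sub_X_pow ℤ).hasProd.tendsto_prod_nat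
  refine ⟨_, h, tendsto_nhds_unique (h.mul tendsto_invPoch) ?_⟩
  simp only [poch_mul_invPoch]
  exact tendsto_const_nhds

/-- Triplets of total size `n` as families over the decompositions of `n`. -/
def tripletEquiv (n : ℕ) : Triplet n ≃ Σ x : Finset.HasAntidiagonal.antidiagonal n,
    (Σ y : Finset.HasAntidiagonal.antidiagonal x.1.1, y.1.1.Partition × Overpartition y.1.2) ×
      Overpartition x.1.2 where
  toFun t := ⟨⟨(t.size₁ + t.size₂, t.size₃), by
    have := t.size_add
    rw [Finset.HasAntidiagonal.mem_antidiagonal]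
    dsimp only
    omega⟩, ⟨⟨(t.size₁, t.size₂), by simp⟩, t.part₁, t.part₂⟩, t.part₃⟩
  invFun s := ⟨s.2.1.1.1.1, s.2.1.1.1.2, s.1.1.2, by
    have h₁ := Finset.HasAntidiagonal.mem_antidiagonal.1 s.1.2
    have h₂ := Finset.HasAntidiagonal.mem_antidiagonal.1 s.2.1.1.2
    omega, s.2.1.2.1, s.2.1.2.2, s.2.2⟩
  left_inv _ := rfl
  right_inv := by
    rintro ⟨⟨⟨a, b⟩, h⟩, ⟨⟨⟨c, d⟩, h'⟩, p, q⟩, r⟩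
    obtain rfl : c + d = a := Finset.HasAntidiagonal.mem_antidiagonal.1 h'
    rfl

lemma tripletSeries_eq :
    tripletSeries = partitionSeries * overpartitionSeries * overpartitionSeries := by
  ext n
  simp only [tripletSeries, partitionSeries, overpartitionSeries, coeff_mul, coeff_mk, ppp]
  rw [Nat.card_congr (tripletEquiv n), Nat.card_sigma]
  push_cast
  refine Eq.trans (Finset.sum_congr rfl fun x _ => ?_)
    (Finset.sum_coe_sort (Finset.HasAntidiagonal.antidiagonal n) fun x : ℕ × ℕ =>
      (∑ y ∈ Finset.HasAntidiagonal.antidiagonal x.1, (Nat.card y.1.Partition : ℤ) *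
        Nat.card (Overpartition y.2)) * (Nat.card (Overpartition x.2) : ℤ))
  rw [Nat.card_prod, Nat.card_sigma]
  push_cast
  refine congrArg (· * _) (Eq.trans (Finset.sum_congr rfl fun y _ => ?_)
    (Finset.sum_coe_sort (Finset.HasAntidiagonal.antidiagonal x.1.1) fun y : ℕ × ℕ =>
      (Nat.card y.1.Partition : ℤ) * Nat.card (Overpartition y.2)))
  rw [Nat.card_prod]
  push_cast
  rfl

lemma ppp_of_neg {m : ℤ} (h : m < 0) : ppp m = 0 := by
  have : IsEmpty (Triplet m) := ⟨fun t => by have := t.size_add; omega⟩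
  exact Nat.card_of_isEmpty

lemma coeff_X_pow_mul_tripletSeries (n e : ℕ) :
    coeff n (X ^ e * tripletSeries) = (ppp ((n : ℤ) - e) : ℤ) := by
  rw [coeff_X_pow_mul']
  split_ifs with h
  · rw [tripletSeries, coeff_mk, Nat.cast_sub h]
  · rw [ppp_of_neg (by omega), Nat.cast_zero]

/-- The products tend to φ·(Oφ)²·P⁴ = P·O², with φ = 1/P. As the Lambert difference dies out, the
bracket becomes -(6K+5) + (6K+7)q^(K+1), the weights of the indices -(K+1) and K+1. -/
lemma tendsto_evenTerm (K : ℕ) : Tendsto (fun a => evenTerm a K) atTop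
    (𝓝 (((6 * K + 7 : ℤ) : ℤ⟦X⟧) * (X ^ pent (K + 1) * tripletSeries)
      - ((6 * K + 5 : ℤ) : ℤ⟦X⟧) * (X ^ (pent K + 2 * K + 1) * tripletSeries))) := by
  obtain ⟨φ, hφ, hφp⟩ := exists_tendsto_poch
  obtain ⟨L, hL⟩ := exists_tendsto_lambert
  have hν : Tendsto negPoch atTop (𝓝 (overpartitionSeries * φ)) := by
    refine (tendsto_negPoch_mul_invPoch.mul hφ).congr fun n => ?_
    linear_combination negPoch n * poch_mul_invPoch n
  have i₁ : Tendsto (fun a : ℕ => a + K + 1) atTop atTop :=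
    tendsto_atTop_mono (fun a => by dsimp; omega) tendsto_id
  have i₂ : Tendsto (fun a : ℕ => 2 * (a + K + 1)) atTop atTop :=
    tendsto_atTop_mono (fun a => by dsimp; omega) tendsto_id
  have i₃ : Tendsto (fun a : ℕ => a + 2 * K + 2) atTop atTop :=
    tendsto_atTop_mono (fun a => by dsimp; omega) tendsto_id
  have := ((((((hφ.comp i₂).mul ((hν.comp i₁).pow 2)).mul (tendsto_invPoch.pow 2)).mul
    ((tendsto_invPoch.comp i₃).pow 2)).const_mul (X ^ (pent K + 2 * K + 1))).mul
    ((((((hL.comp i₃).sub hL).const_mul 4).const_sub (1 - 6 * ((K : ℤ⟦X⟧) + 1))).const_mul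
      (1 - X ^ (K + 1))).add_const (2 * X ^ (K + 1))))
  refine this.mono_right (le_of_eq ?_)
  congr 1
  rw [tripletSeries_eq, pent_succ]
  push_cast
  -- With y = φP, the discrepancy is a multiple of y³ - 1 = (y² + y + 1)(y - 1).
  linear_combination X ^ (pent K + 2 * K + 1) * ((1 - X ^ (K + 1)) * (1 - 6 * ((K : ℤ⟦X⟧) + 1))
    + 2 * X ^ (K + 1)) * overpartitionSeries ^ 2 * partitionSeries *
      ((φ * partitionSeries) ^ 2 + φ * partitionSeries + 1) * hφp

lemma tendsto_evenCenter : Tendsto evenCenter atTop (𝓝 tripletSeries) := by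
  obtain ⟨φ, hφ, hφp⟩ := exists_tendsto_poch
  have hν : Tendsto negPoch atTop (𝓝 (overpartitionSeries * φ)) := by
    refine (tendsto_negPoch_mul_invPoch.mul hφ).congr fun n => ?_
    linear_combination negPoch n * poch_mul_invPoch n
  have i₂ : Tendsto (fun m : ℕ => 2 * m) atTop atTop :=
    tendsto_atTop_mono (fun a => by dsimp; omega) tendsto_id
  have := ((hφ.comp i₂).mul (hν.pow 2)).mul (tendsto_invPoch.pow 4)
  refine this.mono_right (le_of_eq ?_)
  congr 1
  rw [tripletSeries_eq]
  linear_combination overpartitionSeries ^ 2 * partitionSeries *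
      ((φ * partitionSeries) ^ 2 + φ * partitionSeries + 1) * hφp

lemma tendsto_oddTerm (K : ℕ) : Tendsto (fun a => oddTerm a K) atTop
    (𝓝 (((6 * K + 1 : ℤ) : ℤ⟦X⟧) * (X ^ pent K * tripletSeries)
      - ((6 * K + 5 : ℤ) : ℤ⟦X⟧) * (X ^ (pent K + 2 * K + 1) * tripletSeries))) := by
  obtain ⟨φ, hφ, hφp⟩ := exists_tendsto_poch
  obtain ⟨L, hL⟩ := exists_tendsto_lambert
  have hν : Tendsto negPoch atTop (𝓝 (overpartitionSeries * φ)) := by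
    refine (tendsto_negPoch_mul_invPoch.mul hφ).congr fun n => ?_
    linear_combination negPoch n * poch_mul_invPoch n
  have i₁ : Tendsto (fun a : ℕ => a + K) atTop atTop :=
    tendsto_atTop_mono (fun a => by dsimp; omega) tendsto_id
  have i₂ : Tendsto (fun a : ℕ => 2 * (a + K) + 1) atTop atTop :=
    tendsto_atTop_mono (fun a => by dsimp; omega) tendsto_id
  have i₃ : Tendsto (fun a : ℕ => a + 2 * K + 1) atTop atTop :=
    tendsto_atTop_mono (fun a => by dsimp; omega) tendsto_id
  have := ((((((hφ.comp i₂).mul ((hν.comp i₁).pow 2)).mul (tendsto_invPoch.pow 2)).mul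
    ((tendsto_invPoch.comp i₃).pow 2)).const_mul (X ^ pent K)).mul
    ((((((hL.comp i₃).sub hL).const_mul 4).const_add (6 * (K : ℤ⟦X⟧) + 1)).const_mul
      (1 - X ^ (2 * K + 1))).sub_const (4 * X ^ (2 * K + 1))))
  refine this.mono_right (le_of_eq ?_)
  congr 1
  rw [tripletSeries_eq]
  push_cast
  linear_combination X ^ pent K * ((1 - X ^ (2 * K + 1)) * (6 * (K : ℤ⟦X⟧) + 1)
    - 4 * X ^ (2 * K + 1)) * overpartitionSeries ^ 2 * partitionSeries *
      ((φ * partitionSeries) ^ 2 + φ * partitionSeries + 1) * hφp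

/-! ### Coefficients of the limits and signs of the truncated sums -/

/-- The term of index `i` of the sum. -/
noncomputable def term (n : ℕ) (i : ℤ) : ℤ := (6 * i + 1) * (ppp (n - i * (3 * i + 1) / 2) : ℤ)

lemma term_natCast (n K : ℕ) : term n K = (6 * K + 1) * (ppp ((n : ℤ) - pent K) : ℤ) := by
  have h := two_mul_pent K
  have : (K : ℤ) * (3 * K + 1) / 2 = pent K := by
    have : (K : ℤ) * (3 * K + 1) = 2 * pent K := by exact_mod_cast h.symm
    omega
  rw [term, this]

lemma term_neg_succ (n K : ℕ) : term n (-(K + 1 : ℤ))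
    = -(6 * K + 5) * (ppp ((n : ℤ) - (pent K + 2 * K + 1 : ℕ)) : ℤ) := by
  have h := two_mul_pent K
  have : (-(K + 1 : ℤ)) * (3 * (-(K + 1 : ℤ)) + 1) / 2 = (pent K + 2 * K + 1 : ℕ) := by
    have h' : (2 * pent K : ℤ) = K * (3 * K + 1) := by exact_mod_cast h
    have : (-(K + 1 : ℤ)) * (3 * (-(K + 1 : ℤ)) + 1) = 2 * (pent K + 2 * K + 1) := by
      linear_combination -h'
    push_cast
    omega
  rw [term, this]
  ring

lemma coeff_intCast_mul (n : ℕ) (c : ℤ) (f : ℤ⟦X⟧) : coeff n ((c : ℤ⟦X⟧) * f) = c * coeff n f := by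
  rw [← zsmul_eq_mul, map_zsmul, smul_eq_mul]

lemma tendsto_coeff_evenTrunc (n N : ℕ) : Tendsto (fun m => coeff n (evenTrunc m N)) atTop
    (𝓝 (∑ i ∈ Finset.Icc (-N : ℤ) N, term n i)) := by
  induction N with
  | zero =>
    have := ((WithPiTopology.continuous_coeff ℤ n).tendsto _).comp tendsto_evenCenter
    have e : coeff n tripletSeries = term n 0 := by simp [tripletSeries, term]
    simpa [evenTrunc, e, Function.comp_def] using this
  | succ N ih =>
    -- The truncated subtraction only affects small m and is invisible in the limit.
    have i₁ : Tendsto (fun m : ℕ => m - N - 1) atTop atTop :=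
      (tendsto_sub_atTop_nat 1).comp (tendsto_sub_atTop_nat N)
    have := ih.add (((WithPiTopology.continuous_coeff ℤ n).tendsto _).comp
      ((tendsto_evenTerm N).comp i₁))
    simp only [evenTrunc_succ, map_add]
    refine this.mono_right (le_of_eq ?_)
    have hI : Finset.Icc (-(N + 1 : ℕ) : ℤ) (N + 1 : ℕ)
        = insert ((N + 1 : ℕ) : ℤ) (insert (-(N + 1 : ℤ)) (Finset.Icc (-N : ℤ) N)) := by
      ext i
      simp only [Finset.mem_insert, Finset.mem_Icc]
      omega
    rw [hI, Finset.sum_insert (by simp only [Finset.mem_insert, Finset.mem_Icc]; omega),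
      Finset.sum_insert (by simp only [Finset.mem_Icc]; omega), term_natCast, term_neg_succ,
      map_sub, coeff_intCast_mul, coeff_intCast_mul, coeff_X_pow_mul_tripletSeries,
      coeff_X_pow_mul_tripletSeries]
    congr 1
    push_cast
    ring

lemma tendsto_coeff_oddTrunc (n N : ℕ) : Tendsto (fun m => coeff n (oddTrunc m N)) atTop
    (𝓝 (∑ i ∈ Finset.Icc (-(N + 1) : ℤ) N, term n i)) := by
  have key (K : ℕ) : Tendsto (fun m => coeff n (oddTerm (m - K) K)) atTop
      (𝓝 (term n K + term n (-(K + 1 : ℤ)))) := by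
    refine (((WithPiTopology.continuous_coeff ℤ n).tendsto _).comp
      ((tendsto_oddTerm K).comp (tendsto_sub_atTop_nat K))).mono_right (le_of_eq ?_)
    rw [term_natCast, term_neg_succ, map_sub, coeff_intCast_mul, coeff_intCast_mul,
      coeff_X_pow_mul_tripletSeries, coeff_X_pow_mul_tripletSeries]
    ring_nf
  induction N with
  | zero =>
    have h : Finset.Icc (-(((0 : ℕ) : ℤ) + 1)) ((0 : ℕ) : ℤ) = {0, -1} := by
      ext i
      simp only [Finset.mem_insert, Finset.mem_singleton, Finset.mem_Icc]
      omega
    rw [h]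
    simpa [oddTrunc_zero] using key 0
  | succ N ih =>
    have hI : Finset.Icc (-((N + 1 : ℕ) + 1) : ℤ) (N + 1 : ℕ)
        = insert ((N + 1 : ℕ) : ℤ) (insert (-((N + 1 : ℕ) + 1 : ℤ))
          (Finset.Icc (-(N + 1) : ℤ) N)) := by
      ext i
      simp only [Finset.mem_insert, Finset.mem_Icc]
      omega
    simp only [oddTrunc_succ, map_add]
    refine (ih.add (key (N + 1))).mono_right (le_of_eq ?_)
    rw [hI, Finset.sum_insert (by simp only [Finset.mem_insert, Finset.mem_Icc]; omega),
      Finset.sum_insert (by simp only [Finset.mem_Icc]; omega)]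
    congr 1
    ring

lemma sum_term_symm_nonneg (n N : ℕ) (hn : 1 ≤ n) :
    0 ≤ ∑ i ∈ Finset.Icc (-N : ℤ) N, term n i := by
  refine ge_of_tendsto (tendsto_coeff_evenTrunc n N) (eventually_atTop.2 ⟨N + 1, fun m hm => ?_⟩)
  have := mem_nonnegCoeff.1 (evenTrunc_sub_one_mem hm) n
  -- Since n ≥ 1, the constant series 1 contributes nothing to this coefficient.
  rwa [map_sub, coeff_one, if_neg (by omega), sub_zero] at this

lemma sum_term_asymm_nonpos (n N : ℕ) (hn : 1 ≤ n) :
    ∑ i ∈ Finset.Icc (-(N + 1) : ℤ) N, term n i ≤ 0 := by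
  refine le_of_tendsto (tendsto_coeff_oddTrunc n N) (eventually_atTop.2 ⟨N + 1, fun m hm => ?_⟩)
  have := mem_nonnegCoeff.1 (one_sub_oddTrunc_mem hm) n
  rw [map_sub, coeff_one, if_neg (by omega), zero_sub] at this
  linarith

lemma term_nonneg (n : ℕ) {i : ℤ} (hi : 0 ≤ i) : 0 ≤ term n i :=
  mul_nonneg (by omega) (Nat.cast_nonneg _)

lemma term_nonpos (n : ℕ) {i : ℤ} (hi : i < 0) : term n i ≤ 0 :=
  mul_nonpos_of_nonpos_of_nonneg (by omega) (Nat.cast_nonneg _)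

end BilateralQuintuple

open BilateralQuintuple in
theorem corollary1p8 (n : ℕ) (hn : 1 ≤ n) (a b : ℤ) :
    0 ≤ BilateralQuintuple.Sg (a + b) *
      ∑ i ∈ Finset.Icc a b, (6 * i + 1) * (BilateralQuintuple.ppp (n - i * (3 * i + 1) / 2) : ℤ) := by
  change 0 ≤ Sg (a + b) * ∑ i ∈ Finset.Icc a b, term n i
  unfold Sg
  split_ifs with h
  · rw [one_mul]
    rcases le_or_gt 0 a with ha | ha
    · exact Finset.sum_nonneg fun i hi => term_nonneg n (ha.trans (Finset.mem_Icc.1 hi).1)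
    · obtain ⟨N, hN⟩ := Int.eq_ofNat_of_zero_le (show 0 ≤ -a by omega)
      obtain rfl : a = -(N : ℤ) := by omega
      -- From a = -N and a + b ≥ 0 follows b ≥ N; the indices beyond [-N, N] are positive.
      refine (sum_term_symm_nonneg n N hn).trans (Finset.sum_le_sum_of_subset_of_nonneg
        (Finset.Icc_subset_Icc_right (by omega)) fun i hi hi' => term_nonneg n ?_)
      simp only [Finset.mem_Icc] at hi hi'
      omega
  · rw [neg_one_mul, neg_nonneg]
    rcases lt_or_ge b 0 with hb | hb
    · exact Finset.sum_nonpos fun i hi => term_nonpos n ((Finset.mem_Icc.1 hi).2.trans_lt hb)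
    · obtain ⟨N, rfl⟩ := Int.eq_ofNat_of_zero_le hb
      refine le_trans ?_ (sum_term_asymm_nonpos n N hn)
      rw [← neg_le_neg_iff, ← Finset.sum_neg_distrib, ← Finset.sum_neg_distrib]
      -- From b = N and a + b < 0 follows a ≤ -N - 1; the indices beyond [-N-1, N] are negative.
      refine Finset.sum_le_sum_of_subset_of_nonneg
        (Finset.Icc_subset_Icc_left (by omega)) fun i hi hi' => neg_nonneg.2 (term_nonpos n ?_)
      simp only [Finset.mem_Icc] at hi hi'
      omega
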